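/- Let $n\ge 2$ be even and let $\pi=\langle x,y\mid x^n=y^2=(xy)^2=1\rangle$ be the dihedral group of order $2n$. Let $N_x=1+x+\dots+x^{n-1}\in\mathbb{Z}\pi$, and let $d_2\colon \mathbb{Z}\pi^3\to\mathbb{Z}\pi^2$ be the homomorphism of left $\mathbb{Z}\pi$-modules that multiplies row vectors from the right by $$\begin{pmatrix} N_x & -(1+y)\\ 1+xy & x-1\\ 0 & y+1\end{pmatrix},$$ the second differential of the cellular chain complex of the universal cover of the presentation complex of $\langle x,y\mid x^ny^{-2},\,xyxy^{-1},\,y^2\rangle$. Let $d^2\colon\mathbb{Z}\pi^2\to\mathbb{Z}\pi^3$ be the dual of $d_2$, that is, right multiplication by the transposed matrix with the involution $g\mapsto g^{-1}$ of $\mathbb{Z}\pi$ applied to its entries. Put $J=\ker(d_2)$, and let $J^*=\operatorname{Hom}_{\mathbb{Z}}(J,\mathbb{Z})$ carry the action $(g\cdot\varphi)(a)=\varphi(g^{-1}a)$. For an abelian group $A$, let $\Gamma(A)$ be the abelian group with generators $v(a)$, $a\in A$, and relations $v(-a)=v(a)$ and $v(a+b+c)-v(b+c)-v(c+a)-v(a+b)+v(a)+v(b)+v(c)=0$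 for $a,b,c\in A$; if $\pi$ acts on $A$ by automorphisms, let $\pi$ act on $\Gamma(A)$ by $g\cdot v(a)=v(ga)$. For a $\mathbb{Z}\pi$-module $M$, let $\widehat H_0(\pi;M)$ be the kernel of the norm map $\mathbb{Z}\otimes_{\mathbb{Z}\pi}M\to M^\pi$, $1\otimes m\mapsto\sum_{g\in\pi}gm$. Then $\operatorname{coker}(d^2)\cong J^*$ as $\mathbb{Z}\pi$-modules, and $$\widehat H_0(\pi;\Gamma(\operatorname{coker}(d^2)))=0.$$ -/

import Mathlib

/-!
Whitehead's quadratic functor, the zeroth Tate homology group of a finite group, and the modules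
`ker d₂` and `coker d²` over the integral group ring of a dihedral group.
-/

/-- The relators `v(-a) - v(a)` and
`v(a+b+c) - v(b+c) - v(c+a) - v(a+b) + v(a) + v(b) + v(c)` of Whitehead's group `Γ(A)`. -/
inductive WhiteheadRel (A : Type*) [AddCommGroup A] : FreeAbelianGroup A → Prop
  | neg (a : A) : WhiteheadRel A (FreeAbelianGroup.of (-a) - FreeAbelianGroup.of a)
  | cubic (a b c : A) : WhiteheadRel A
      (FreeAbelianGroup.of (a + b + c) - FreeAbelianGroup.of (b + c) - FreeAbelianGroup.of (c + a)
        - FreeAbelianGroup.of (a + b) + FreeAbelianGroup.of a + FreeAbelianGroup.of b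
        + FreeAbelianGroup.of c)

/-- Whitehead's group `Γ(A)`: the abelian group generated by symbols `v(a)`, `a ∈ A`, subject to
the relations above. -/
def WhiteheadGamma (A : Type*) [AddCommGroup A] : Type _ :=
  FreeAbelianGroup A ⧸ AddSubgroup.closure {z | WhiteheadRel A z}

namespace WhiteheadGamma

variable {A B C : Type*} [AddCommGroup A] [AddCommGroup B] [AddCommGroup C]

instance : AddCommGroup (WhiteheadGamma A) :=
  inferInstanceAs (AddCommGroup (FreeAbelianGroup A ⧸ AddSubgroup.closure {z | WhiteheadRel A z}))

/-- The generator `v(a)` of `Γ(A)`. -/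
def v (a : A) : WhiteheadGamma A :=
  QuotientAddGroup.mk' (AddSubgroup.closure {z | WhiteheadRel A z}) (FreeAbelianGroup.of a)

/-- The homomorphism `f_* : Γ(A) → Γ(B)`, `v(a) ↦ v(f a)`, induced by `f : A → B`. -/
def map (f : A →+ B) : WhiteheadGamma A →+ WhiteheadGamma B :=
  QuotientAddGroup.map _ _ (FreeAbelianGroup.map f) (by
    rw [AddSubgroup.closure_le]
    rintro z (⟨a⟩ | ⟨a, b, c⟩)
    · refine AddSubgroup.subset_closure ?_
      simpa using WhiteheadRel.neg (f a)
    · refine AddSubgroup.subset_closure ?_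
      simpa using WhiteheadRel.cubic (f a) (f b) (f c))

@[simp] theorem map_v (f : A →+ B) (a : A) : map f (v a) = v (f a) := rfl

theorem hom_ext {f g : WhiteheadGamma A →+ C} (h : ∀ a, f (v a) = g (v a)) : f = g := by
  refine QuotientAddGroup.addMonoidHom_ext _ ?_
  ext a
  exact h a

/-- The action of a group on `Γ(A)` induced by an action on `A`, so that `g • v(a) = v(g • a)`. -/
def rep {G : Type*} [Monoid G] (ρ : Representation ℤ G A) :
    Representation ℤ G (WhiteheadGamma A) where
  toFun g := (map (ρ g).toAddMonoidHom).toIntLinearMap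
  map_one' := by
    refine LinearMap.toAddMonoidHom_injective (hom_ext fun a => ?_)
    simp
  map_mul' g h := by
    refine LinearMap.toAddMonoidHom_injective (hom_ext fun a => ?_)
    simp

end WhiteheadGamma

/-- The norm map `N : A_π → A^π`, `[a] ↦ ∑ g, g • a`, from coinvariants to invariants. -/
noncomputable def tateNorm {G A : Type*} [Group G] [Fintype G] [AddCommGroup A]
    (ρ : Representation ℤ G A) : ρ.Coinvariants →ₗ[ℤ] ρ.invariants :=
  Representation.Coinvariants.lift ρ
    (ρ.norm.codRestrict ρ.invariants fun a g => ρ.self_norm_apply g a)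
    fun g => LinearMap.ext fun a => Subtype.ext (ρ.norm_self_apply g a)

/-- The zeroth Tate homology group `Ĥ₀(π; A) = ker (N : A_π → A^π)`. -/
noncomputable abbrev TateH0 {G A : Type*} [Group G] [Fintype G] [AddCommGroup A]
    (ρ : Representation ℤ G A) : Type _ :=
  LinearMap.ker (tateNorm ρ)

namespace DihedralSyzygy

/-- The integral group ring `ℤπ` of the dihedral group `π` of order `2n`. -/
abbrev R (n : ℕ) : Type := MonoidAlgebra ℤ (DihedralGroup n)

/-- The rotation `x` of order `n`, as an element of `ℤπ`. -/
noncomputable def x (n : ℕ) : R n := MonoidAlgebra.of ℤ _ (DihedralGroup.r 1)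

/-- The reflection `y`, as an element of `ℤπ`; here `y² = 1` and `x y x = y`. -/
noncomputable def y (n : ℕ) : R n := MonoidAlgebra.of ℤ _ (DihedralGroup.sr 0)

/-- `N_x = 1 + x + ⋯ + x^(n-1)`. -/
noncomputable def Nx (n : ℕ) : R n := ∑ i ∈ Finset.range n, x n ^ i

/-- The involution of `ℤπ` with `g ↦ g⁻¹` for `g ∈ π`. -/
noncomputable def bar (n : ℕ) (a : R n) : R n := MonoidAlgebra.mapDomain (fun g => g⁻¹) a

/-- The matrix of the second differential of the cellular chain complex of the universal cover of
the presentation complex of `⟨x, y | xⁿ y⁻², x y x y⁻¹, y²⟩`. -/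
noncomputable def d2Matrix (n : ℕ) : Matrix (Fin 3) (Fin 2) (R n) :=
  !![Nx n, -(1 + y n);
     1 + x n * y n, x n - 1;
     0, y n + 1]

/-- `d₂ : ℤπ³ → ℤπ²`: row vectors are multiplied by the matrix from the right, so that the map is
linear for the left module structures. -/
noncomputable def d2 (n : ℕ) : (Fin 3 → R n) →ₗ[R n] (Fin 2 → R n) :=
  (d2Matrix n).vecMulLinear

/-- The dual `d² : ℤπ² → ℤπ³` of `d₂`, given by the transpose of the matrix of `d₂` with the
involution applied to its entries. -/
noncomputable def dUp2 (n : ℕ) : (Fin 2 → R n) →ₗ[R n] (Fin 3 → R n) :=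
  ((d2Matrix n).transpose.map (bar n)).vecMulLinear

/-- The left `ℤπ`-module `J = ker d₂`. -/
abbrev Ker (n : ℕ) : Type := LinearMap.ker (d2 n)

/-- The left `ℤπ`-module `coker d²`. -/
abbrev Coker (n : ℕ) : Type := (Fin 3 → R n) ⧸ LinearMap.range (dUp2 n)

/-- The action of `π` on `ker d₂`. -/
noncomputable def kerRep (n : ℕ) : Representation ℤ (DihedralGroup n) (Ker n) :=
  Representation.ofModule' (Ker n)

/-- The action of `π` on `coker d²`. -/
noncomputable def cokerRep (n : ℕ) : Representation ℤ (DihedralGroup n) (Coker n) :=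
  Representation.ofModule' (Coker n)

end DihedralSyzygy

/-- A homomorphism from the kernel of a map to a finite free module over `ℤ` extends to the whole module. -/
theorem exists_extend_from_ker {A B : Type*} [AddCommGroup A] [AddCommGroup B]
    [Module.Free ℤ B] [Module.Finite ℤ B] (f : A →ₗ[ℤ] B) (φ : LinearMap.ker f →ₗ[ℤ] ℤ) :
    ∃ ψ : A →ₗ[ℤ] ℤ, ∀ a : LinearMap.ker f, ψ a = φ a := by
  obtain ⟨s, hs⟩ := Module.projective_lifting_property f.rangeRestrict LinearMap.id
    f.surjective_rangeRestrict
  have hs' : ∀ b, f.rangeRestrict (s b) = b := fun b => LinearMap.congr_fun hs b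
  let π : A →ₗ[ℤ] LinearMap.ker f :=
    LinearMap.codRestrict _ (LinearMap.id - s ∘ₗ f.rangeRestrict) fun a => by
      have := congrArg Subtype.val (hs' (f.rangeRestrict a))
      simp only [LinearMap.codRestrict_apply, LinearMap.rangeRestrict] at this
      simp [LinearMap.mem_ker, LinearMap.rangeRestrict, this]
  refine ⟨φ ∘ₗ π, fun a => ?_⟩
  have : π a = a := Subtype.ext <| by
    have h : f.rangeRestrict (a : A) = 0 := Subtype.ext a.2
    simp [π, h]
  simp [this]

namespace DihedralSyzygy

open DihedralGroup MonoidAlgebra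

variable {n : ℕ}

theorem x_eq : x n = single (r 1) 1 := rfl

theorem y_eq : y n = single (sr 0) 1 := rfl

theorem x_pow (k : ℕ) : x n ^ k = single (r (k : ZMod n)) 1 := by
  rw [x, ← map_pow, r_one_pow]; rfl

theorem sum_zmod_eq_sum_range [NeZero n] {M : Type*} [AddCommMonoid M] (f : ZMod n → M) :
    ∑ k, f k = ∑ i ∈ Finset.range n, f i := by
  symm
  refine Finset.sum_bij' (fun k _ => (k : ZMod n)) (fun k _ => k.val) ?_ ?_ ?_ ?_ ?_
  · simp
  · intro k _; simpa using ZMod.val_lt k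
  · intro k hk; exact ZMod.val_cast_of_lt (Finset.mem_range.1 hk)
  · simp
  · simp

theorem Nx_eq [NeZero n] : Nx n = ∑ k : ZMod n, single (r k) 1 := by
  simp only [Nx, x_pow, sum_zmod_eq_sum_range]

@[simp] theorem bar_single (g : DihedralGroup n) (c : ℤ) :
    bar n (single g c) = single g⁻¹ c := by
  simp [bar]

@[simp] theorem bar_one : bar n 1 = 1 := by
  rw [MonoidAlgebra.one_def, bar_single, inv_one]

@[simp] theorem bar_zero : bar n 0 = 0 := by simp [bar]

@[simp] theorem bar_add (a b : R n) : bar n (a + b) = bar n a + bar n b := by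
  simp [bar, mapDomain_add]

/-- The involution of the group ring as an additive map. -/
noncomputable def barHom (n : ℕ) : R n →+ R n := AddMonoidHom.mk' (bar n) bar_add

@[simp] theorem bar_neg (a : R n) : bar n (-a) = -bar n a := map_neg (barHom n) a

@[simp] theorem bar_sub (a b : R n) : bar n (a - b) = bar n a - bar n b := map_sub (barHom n) a b

@[simp] theorem bar_sum {ι : Type*} (s : Finset ι) (f : ι → R n) :
    bar n (∑ i ∈ s, f i) = ∑ i ∈ s, bar n (f i) := map_sum (barHom n) f s

@[simp] theorem bar_mul (a b : R n) : bar n (a * b) = bar n b * bar n a := by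
  induction a using MonoidAlgebra.induction_linear with
  | zero => simp
  | add a a' ha ha' => simp [add_mul, mul_add, ha, ha']
  | single g c =>
    induction b using MonoidAlgebra.induction_linear with
    | zero => simp
    | add b b' hb hb' => simp [add_mul, mul_add, hb, hb']
    | single h d => simp [mul_comm]

@[simp] theorem bar_bar (a : R n) : bar n (bar n a) = a := by
  induction a using MonoidAlgebra.induction_linear with
  | zero => simp
  | add a a' ha ha' => simp [ha, ha']
  | single g c => simp

/-- The standard inner product of two elements of the group ring. -/
theorem coeff_mul_bar_one [NeZero n] (a b : R n) :
    (a * bar n b).coeff 1 = ∑ g, a.coeff g * b.coeff g := by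
  induction a using MonoidAlgebra.induction_linear with
  | zero => simp
  | add a a' ha ha' => simp [add_mul, Finset.sum_add_distrib, ha, ha']
  | single g c =>
    induction b using MonoidAlgebra.induction_linear with
    | zero => simp
    | add b b' hb hb' =>
      simp only [bar_add, mul_add, coeff_add, Finsupp.add_apply, hb, hb', Finset.sum_add_distrib]
    | single h d =>
      by_cases hgh : g = h <;> simp [Finsupp.single_apply, mul_inv_eq_one, hgh, eq_comm]

/-- The standard `ℤ`-valued inner product on a free module over the group ring. -/
noncomputable def dot {ι : Type*} [Fintype ι] (n : ℕ) [NeZero n] :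
    (ι → R n) →ₗ[ℤ] (ι → R n) →ₗ[ℤ] ℤ :=
  LinearMap.mk₂ ℤ (fun u w => ∑ i, ∑ g, (u i).coeff g * (w i).coeff g)
    (by intros; simp [add_mul, Finset.sum_add_distrib])
    (by intros; simp only [Pi.smul_apply, coeff_smul, Finsupp.smul_apply, smul_eq_mul,
      Finset.mul_sum, mul_assoc])
    (by intros; simp [mul_add, Finset.sum_add_distrib])
    (by intros; simp only [Pi.smul_apply, coeff_smul, Finsupp.smul_apply, smul_eq_mul,
      Finset.mul_sum, mul_left_comm])

variable {ι : Type*} [Fintype ι] [NeZero n]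

theorem dot_apply (u w : ι → R n) : dot n u w = ∑ i, ∑ g, (u i).coeff g * (w i).coeff g := rfl

theorem dot_eq (u w : ι → R n) : dot n u w = (∑ i, u i * bar n (w i)).coeff 1 := by
  simp [dot_apply, coeff_mul_bar_one]

theorem dot_single_smul (g : DihedralGroup n) (u w : ι → R n) :
    dot n (single g (1 : ℤ) • u) w = dot n u (single g⁻¹ (1 : ℤ) • w) := by
  simp only [dot_apply, Pi.smul_apply, smul_eq_mul]
  refine Finset.sum_congr rfl fun i _ => ?_
  refine Fintype.sum_equiv (Equiv.mulLeft g⁻¹) _ _ fun h => ?_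
  simp [coeff_single_mul_apply]

theorem dot_single [DecidableEq ι] (u : ι → R n) (i : ι) (g : DihedralGroup n) :
    dot n u (Pi.single i (single g 1)) = (u i).coeff g := by
  rw [dot_apply, Finset.sum_eq_single i, Finset.sum_eq_single g] <;>
    simp +contextual [Finsupp.single_apply, eq_comm]

theorem dot_left_injective {u : ι → R n} (h : ∀ w, dot n u w = 0) : u = 0 := by
  classical
  ext i g
  simpa [dot_single] using h (Pi.single i (single g 1))

theorem exists_dot_eq (φ : (ι → R n) →ₗ[ℤ] ℤ) : ∃ u, ∀ w, dot n u w = φ w := by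
  classical
  refine ⟨fun i => .ofCoeff <| Finsupp.equivFunOnFinite.symm
    fun g => φ (Pi.single i (single g 1)), fun w => ?_⟩
  refine LinearMap.congr_fun (f := dot n _) ?_ w
  ext i g
  simp [dot_single]

end DihedralSyzygy

namespace DihedralSyzygy

open DihedralGroup MonoidAlgebra

variable {n : ℕ}

theorem d2_apply (u : Fin 3 → R n) :
    d2 n u = ![u 0 * Nx n + u 1 * (1 + x n * y n),
      -(u 0 * (1 + y n)) + u 1 * (x n - 1) + u 2 * (y n + 1)] := by
  ext i : 1
  fin_cases i <;> simp [d2, d2Matrix, Matrix.vecMul, dotProduct, Fin.sum_univ_three, mul_add]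

/-- The augmentation-type map `d₁ : ℤπ² → ℤπ` whose kernel is the image of `d₂`. -/
noncomputable def d1 (n : ℕ) : (Fin 2 → R n) →ₗ[R n] R n :=
  (LinearMap.toSpanSingleton (R n) (R n) (x n - 1)) ∘ₗ LinearMap.proj 0 +
    (LinearMap.toSpanSingleton (R n) (R n) (y n - 1)) ∘ₗ LinearMap.proj 1

theorem d1_apply (w : Fin 2 → R n) : d1 n w = w 0 * (x n - 1) + w 1 * (y n - 1) := by
  simp [d1]

theorem y_mul_y : y n * y n = 1 := by simp [y_eq, MonoidAlgebra.one_def]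

theorem x_mul_y_mul_x : x n * y n * x n = y n := by simp [x_eq, y_eq]

variable [NeZero n]

theorem Nx_mul_single_r (k : ZMod n) : Nx n * single (r k) (1 : ℤ) = Nx n := by
  rw [Nx_eq, Finset.sum_mul]
  exact Fintype.sum_equiv (Equiv.addRight k) _ _ fun i => by simp

theorem d1_d2 (u : Fin 3 → R n) : d1 n (d2 n u) = 0 := by
  have h1 : Nx n * (x n - 1) = 0 := by rw [mul_sub, x_eq, Nx_mul_single_r]; simp
  have h2 : (y n + 1) * (y n - 1) = 0 := by
    rw [add_mul, mul_sub, y_mul_y]; simp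
  have h3 : (1 + x n * y n) * (x n - 1) + (x n - 1) * (y n - 1) = 0 := by
    simp only [add_mul, mul_sub, sub_mul, one_mul, mul_one, x_mul_y_mul_x]
    abel
  rw [d1_apply, d2_apply]
  simp only [Matrix.cons_val_zero, Matrix.cons_val_one]
  calc _ = u 0 * (Nx n * (x n - 1)) - u 0 * ((y n + 1) * (y n - 1)) +
        u 1 * ((1 + x n * y n) * (x n - 1) + (x n - 1) * (y n - 1)) +
        u 2 * ((y n + 1) * (y n - 1)) := by
          simp only [mul_add, mul_sub, add_mul, sub_mul, neg_mul, mul_assoc, mul_one, one_mul]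
          abel
    _ = 0 := by rw [h1, h2, h3]; simp

/-- The element of the group ring of the cyclic subgroup with the given coefficients. -/
noncomputable def rot (c : ZMod n → ℤ) : R n := ∑ k, single (r k) (c k)

theorem rot_add (c d : ZMod n → ℤ) : rot (c + d) = rot c + rot d := by
  simp [rot, Finset.sum_add_distrib]

theorem rot_single (k : ZMod n) (a : ℤ) : rot (Pi.single k a) = single (r k) a := by
  rw [rot, Finset.sum_eq_single k] <;> simp +contextual

theorem coeff_rot_r (c : ZMod n → ℤ) (k : ZMod n) : (rot c).coeff (r k) = c k := by
  simp [rot, Finsupp.single_apply]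

theorem coeff_rot_sr (c : ZMod n → ℤ) (k : ZMod n) : (rot c).coeff (sr k) = 0 := by
  simp [rot]

@[simp] theorem rot_zero : rot (0 : ZMod n → ℤ) = 0 := by simp [rot]

theorem exists_rot_sub_mem_range (w : Fin 2 → R n) :
    ∃ c d : ZMod n → ℤ, w - ![rot c, rot d] ∈ LinearMap.range (d2 n) := by
  have add : ∀ w w' : Fin 2 → R n,
      (∃ c d : ZMod n → ℤ, w - ![rot c, rot d] ∈ LinearMap.range (d2 n)) →
      (∃ c d : ZMod n → ℤ, w' - ![rot c, rot d] ∈ LinearMap.range (d2 n)) →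
      ∃ c d : ZMod n → ℤ, w + w' - ![rot c, rot d] ∈ LinearMap.range (d2 n) := by
    rintro w w' ⟨c, d, h⟩ ⟨c', d', h'⟩
    refine ⟨c + c', d + d', ?_⟩
    convert add_mem h h' using 1
    ext i : 1
    fin_cases i <;> simp [rot_add, Matrix.vecHead, Matrix.vecTail] <;> abel
  have zero : ∃ c d : ZMod n → ℤ,
      (0 : Fin 2 → R n) - ![rot c, rot d] ∈ LinearMap.range (d2 n) :=
    ⟨0, 0, 0, by ext i : 1; fin_cases i <;> simp⟩
  have fst : ∀ a : R n, ∃ c d : ZMod n → ℤ,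
      ![a, 0] - ![rot c, rot d] ∈ LinearMap.range (d2 n) := by
    intro a
    induction a using MonoidAlgebra.induction_linear with
    | zero => simpa using zero
    | add a a' ha ha' => simpa using add _ _ ha ha'
    | single g a =>
      rcases g with k | j
      · exact ⟨Pi.single k a, 0, by simp [rot_single]⟩
      · refine ⟨Pi.single (-j - 1) (-a), Pi.single (-j - 1) a + Pi.single (-j) (-a),
          ![0, single (r (-j - 1)) a, 0], ?_⟩
        rw [d2_apply]
        ext i : 1
        fin_cases i <;> simp [rot_add, rot_single, x_eq, y_eq, mul_add, mul_sub, single_neg]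
        · rw [show -1 - (-j - 1) = j by ring, add_comm]
        · abel
  have snd : ∀ a : R n, ∃ c d : ZMod n → ℤ,
      ![0, a] - ![rot c, rot d] ∈ LinearMap.range (d2 n) := by
    intro a
    induction a using MonoidAlgebra.induction_linear with
    | zero => simpa using zero
    | add a a' ha ha' => simpa using add _ _ ha ha'
    | single g a =>
      rcases g with k | j
      · exact ⟨0, Pi.single k a, by simp [rot_single]⟩
      · refine ⟨0, Pi.single (-j) (-a), ![0, 0, single (r (-j)) a], ?_⟩
        rw [d2_apply]
        ext i : 1
        fin_cases i <;> simp [rot_single, y_eq, mul_add, single_neg]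
  have hw : w = ![w 0, 0] + ![0, w 1] := by
    ext i : 1
    fin_cases i <;> simp
  rw [hw]
  exact add _ _ (fst _) (snd _)

theorem eq_apply_zero_of_forall_sub_one {c : ZMod n → ℤ} (h : ∀ k, c (k - 1) = c k)
    (k : ZMod n) : c k = c 0 := by
  rw [← ZMod.natCast_zmod_val k]
  induction k.val with
  | zero => simp
  | succ m ih => rw [← h, ← ih]; simp

/-- Exactness at the first term of the cellular chain complex. -/
theorem range_d2 : LinearMap.range (d2 n) = LinearMap.ker (d1 n) := by
  ext w
  constructor
  · rintro ⟨u, rfl⟩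
    exact d1_d2 u
  · intro hw
    obtain ⟨c, d, u, hu⟩ := exists_rot_sub_mem_range w
    have hcd : d1 n ![rot c, rot d] = 0 := by
      have := d1_d2 u
      rw [hu, map_sub, LinearMap.mem_ker.1 hw, zero_sub, neg_eq_zero] at this
      exact this
    rw [d1_apply] at hcd
    simp only [Matrix.cons_val_zero, Matrix.cons_val_one, mul_sub, mul_one] at hcd
    have hd : d = 0 := by
      ext k
      have := congrArg (fun a : R n => a.coeff (sr (-k))) hcd
      simpa [x_eq, y_eq, coeff_rot_r, coeff_rot_sr] using this
    have hc : ∀ k, c (k - 1) = c k := by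
      intro k
      have := congrArg (fun a : R n => a.coeff (r k)) hcd
      simp [x_eq, y_eq, coeff_rot_r, hd, ← sub_eq_add_neg] at this
      linarith
    have hw' : w = d2 n (u + ![single 1 (c 0), 0, single 1 (c 0)]) := by
      rw [map_add, hu, d2_apply, hd]
      have : rot c = single 1 (c 0) * Nx n := by
        rw [Nx_eq, rot, Finset.mul_sum]
        exact Finset.sum_congr rfl fun k _ => by
          simp [eq_apply_zero_of_forall_sub_one hc k]
      ext i : 1
      fin_cases i <;> simp [this, mul_add, Matrix.vecHead, Matrix.vecTail]
      abel
    exact ⟨_, hw'.symm⟩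

omit [NeZero n] in
theorem dUp2_apply_mul (u : Fin 2 → R n) (w : Fin 3 → R n) :
    ∑ i, dUp2 n u i * bar n (w i) = ∑ j, u j * bar n (d2 n w j) := by
  simp only [dUp2, d2, Matrix.vecMulLinear_apply, Matrix.vecMul, dotProduct, Finset.sum_mul,
    Matrix.map_apply, Matrix.transpose_apply, bar_sum, bar_mul, Finset.mul_sum, mul_assoc]
  exact Finset.sum_comm

theorem dot_dUp2 (u : Fin 2 → R n) (w : Fin 3 → R n) :
    dot n (dUp2 n u) w = dot n u (d2 n w) := by
  rw [dot_eq, dot_eq, dUp2_apply_mul]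

/-- The restriction to `ker d₂` of the functional `⟨u, ·⟩`. -/
noncomputable def toDualKer (n : ℕ) [NeZero n] : (Fin 3 → R n) →ₗ[ℤ] Module.Dual ℤ (Ker n) :=
  (LinearMap.lcomp ℤ ℤ ((LinearMap.ker (d2 n)).subtype.restrictScalars ℤ)) ∘ₗ dot n

theorem toDualKer_apply (u : Fin 3 → R n) (a : Ker n) : toDualKer n u a = dot n u a := rfl

theorem toDualKer_surjective : Function.Surjective (toDualKer n) := by
  intro φ
  obtain ⟨ψ, hψ⟩ := exists_extend_from_ker ((d2 n).restrictScalars ℤ) φ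
  obtain ⟨u, hu⟩ := exists_dot_eq ψ
  exact ⟨u, LinearMap.ext fun a => (hu a).trans (hψ a)⟩

theorem ker_toDualKer :
    LinearMap.ker (toDualKer n) = (LinearMap.range (dUp2 n)).restrictScalars ℤ := by
  ext u
  constructor
  · intro hu
    have hle : LinearMap.ker ((d2 n).restrictScalars ℤ) ≤ LinearMap.ker (dot n u) := fun a ha =>
      LinearMap.congr_fun hu ⟨a, ha⟩
    let χ : LinearMap.range ((d2 n).restrictScalars ℤ) →ₗ[ℤ] ℤ :=
      (LinearMap.ker ((d2 n).restrictScalars ℤ)).liftQ (dot n u) hle ∘ₗ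
        ((d2 n).restrictScalars ℤ).quotKerEquivRange.symm.toLinearMap
    have hχ : ∀ w, χ ⟨d2 n w, w, rfl⟩ = dot n u w := fun w => by
      have : ((d2 n).restrictScalars ℤ).quotKerEquivRange.symm ⟨d2 n w, w, rfl⟩ =
          Submodule.Quotient.mk w := by
        rw [LinearEquiv.symm_apply_eq]; rfl
      simp only [χ, LinearMap.comp_apply, LinearEquiv.coe_coe, this]
      rfl
    have hrange : LinearMap.ker ((d1 n).restrictScalars ℤ) ≤
        LinearMap.range ((d2 n).restrictScalars ℤ) := fun w hw =>
      (range_d2 (n := n)).ge hw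
    obtain ⟨ψ, hψ⟩ := exists_extend_from_ker _ (χ ∘ₗ Submodule.inclusion hrange)
    obtain ⟨v, hv⟩ := exists_dot_eq ψ
    refine ⟨v, ?_⟩
    rw [← sub_eq_zero]
    refine dot_left_injective fun w => ?_
    rw [map_sub, LinearMap.sub_apply, dot_dUp2, hv, sub_eq_zero, ← hχ]
    exact hψ ⟨d2 n w, d1_d2 w⟩
  · rintro ⟨v, rfl⟩
    refine LinearMap.ext fun a => ?_
    rw [toDualKer_apply, dot_dUp2, LinearMap.mem_ker.1 a.2]
    simp

omit [NeZero n] in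
theorem cokerRep_apply (g : DihedralGroup n) (a : Coker n) :
    cokerRep n g a = single g (1 : ℤ) • a := by
  simp [cokerRep, Representation.ofModule']

omit [NeZero n] in
theorem kerRep_apply (g : DihedralGroup n) (a : Ker n) :
    kerRep n g a = single g (1 : ℤ) • a := by
  simp [kerRep, Representation.ofModule']

/-- The isomorphism of abelian groups between `coker d²` and the dual of `ker d₂`. -/
noncomputable def cokerLinearEquivDualKer (n : ℕ) [NeZero n] :
    Coker n ≃ₗ[ℤ] Module.Dual ℤ (Ker n) :=
  (Submodule.Quotient.restrictScalarsEquiv ℤ (LinearMap.range (dUp2 n))).symm ≪≫ₗ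
    Submodule.quotEquivOfEq _ _ ker_toDualKer.symm ≪≫ₗ
    (toDualKer n).quotKerEquivOfSurjective toDualKer_surjective

theorem cokerLinearEquivDualKer_mk (u : Fin 3 → R n) :
    cokerLinearEquivDualKer n (Submodule.Quotient.mk u) = toDualKer n u := rfl

/-- The cokernel of `d²` is the dual of the kernel of `d₂`. -/
theorem nonempty_cokerRep_equiv_dual_kerRep :
    Nonempty ((cokerRep n).Equiv (kerRep n).dual) := by
  refine ⟨.mk (cokerLinearEquivDualKer n) fun g => LinearMap.ext fun u => ?_⟩
  obtain ⟨u, rfl⟩ := Submodule.Quotient.mk_surjective _ u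
  refine LinearMap.ext fun a => ?_
  simp only [LinearMap.comp_apply, LinearEquiv.coe_coe, cokerRep_apply,
    ← Submodule.Quotient.mk_smul, cokerLinearEquivDualKer_mk, Representation.dual_apply,
    Module.Dual.transpose_apply, toDualKer_apply, kerRep_apply, dot_single_smul]
  rfl

end DihedralSyzygy

namespace WhiteheadGamma

variable {A : Type*} [AddCommGroup A]

theorem v_neg (a : A) : v (-a) = v a := by
  rw [← sub_eq_zero]
  exact (QuotientAddGroup.eq_zero_iff _).2 (AddSubgroup.subset_closure (WhiteheadRel.neg a))

theorem v_cubic (a b c : A) :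
    v (a + b + c) - v (b + c) - v (c + a) - v (a + b) + v a + v b + v c = 0 :=
  (QuotientAddGroup.eq_zero_iff _).2 (AddSubgroup.subset_closure (WhiteheadRel.cubic a b c))

@[simp] theorem v_zero : v (0 : A) = 0 := by
  simpa using v_cubic (0 : A) 0 0

/-- The symmetric bilinear map `(a, b) ↦ v(a + b) - v(a) - v(b)`. -/
def polar : A →+ A →+ WhiteheadGamma A :=
  AddMonoidHom.mk' (fun a => AddMonoidHom.mk' (fun b => v (a + b) - v a - v b) fun b c => by
      have h := v_cubic a b c
      rw [← sub_eq_zero, ← h, add_comm c a, add_assoc a b c]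
      abel)
    fun a b => by
      ext c
      have h := v_cubic a b c
      simp only [AddMonoidHom.mk'_apply, AddMonoidHom.add_apply]
      rw [← sub_eq_zero, ← h, add_comm c a]
      abel

theorem polar_apply (a b : A) : polar a b = v (a + b) - v a - v b := rfl

theorem polar_comm (a b : A) : polar a b = polar b a := by
  rw [polar_apply, polar_apply, add_comm a b]; abel

theorem v_add (a b : A) : v (a + b) = v a + v b + polar a b := by
  rw [polar_apply]; abel

theorem polar_self (a : A) : polar a a = v a + v a := by
  have h : polar a (-a) = -polar a a := map_neg _ _
  rw [polar_apply a (-a), v_neg, add_neg_cancel, v_zero] at h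
  rw [eq_comm, ← neg_inj, ← h]; abel

/-- The homomorphism out of `Γ(A)` given by the quadratic map of a symmetric bilinear map. -/
def liftBilin {L : Type*} [AddCommGroup L] (B : A →+ A →+ L) : WhiteheadGamma A →+ L :=
  QuotientAddGroup.lift _ (FreeAbelianGroup.lift fun a => B a a) (by
    rw [AddSubgroup.closure_le]
    rintro z (⟨a⟩ | ⟨a, b, c⟩)
    · simp
    · simp; abel)

@[simp] theorem liftBilin_v {L : Type*} [AddCommGroup L] (B : A →+ A →+ L) (a : A) :
    liftBilin B (v a) = B a a := by
  change FreeAbelianGroup.lift (fun a => B a a) (FreeAbelianGroup.of a) = _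
  simp

theorem liftBilin_polar {L : Type*} [AddCommGroup L] (B : A →+ A →+ L) (a b : A) :
    liftBilin B (polar a b) = B a b + B b a := by
  simp [polar_apply]; abel

theorem closure_range_v : AddSubgroup.closure (Set.range (v : A → WhiteheadGamma A)) = ⊤ := by
  rw [eq_top_iff]
  rintro z -
  obtain ⟨z, rfl⟩ := QuotientAddGroup.mk_surjective z
  induction z using FreeAbelianGroup.induction_on with
  | zero => exact zero_mem _
  | of a => exact AddSubgroup.subset_closure ⟨a, rfl⟩
  | neg a h => exact neg_mem (AddSubgroup.subset_closure (Set.mem_range_self (f := v) a))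
  | add a b ha hb => exact add_mem ha hb

/-- If the values of `v` and of `polar` on generators of `A` lie in a subgroup, then the subgroup
is all of `Γ(A)`. -/
theorem addSubgroup_eq_top {S : Set A} (hS : AddSubgroup.closure S = ⊤)
    {P : AddSubgroup (WhiteheadGamma A)} (hv : ∀ a ∈ S, v a ∈ P)
    (hpolar : ∀ a ∈ S, ∀ b ∈ S, polar a b ∈ P) : P = ⊤ := by
  have h1 : ∀ a, ∀ b ∈ S, polar a b ∈ P := fun a b hb => by
    have ha : a ∈ AddSubgroup.closure S := hS ▸ AddSubgroup.mem_top a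
    induction ha using AddSubgroup.closure_induction with
    | mem a ha => exact hpolar a ha b hb
    | zero => simp
    | add a a' _ _ ha ha' => simpa using add_mem ha ha'
    | neg a _ ha => simpa using ha
  have h2 : ∀ a b, polar a b ∈ P := fun a b => by
    have hb : b ∈ AddSubgroup.closure S := hS ▸ AddSubgroup.mem_top b
    induction hb using AddSubgroup.closure_induction with
    | mem b hb => exact h1 a b hb
    | zero => simp
    | add b b' _ _ hb hb' => simpa using add_mem hb hb'
    | neg b _ hb => simpa using hb
  rw [eq_top_iff, ← closure_range_v, AddSubgroup.closure_le]
  rintro _ ⟨a, rfl⟩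
  have ha : a ∈ AddSubgroup.closure S := hS ▸ AddSubgroup.mem_top a
  induction ha using AddSubgroup.closure_induction with
  | mem a ha => exact hv a ha
  | zero => simp
  | add a a' _ _ ha ha' => rw [v_add]; exact add_mem (add_mem ha ha') (h2 a a')
  | neg a _ ha => rwa [v_neg]

section Rep

variable {G : Type*} [Group G] (ρ : Representation ℤ G A)

@[simp] theorem rep_v (g : G) (a : A) : rep ρ g (v a) = v (ρ g a) := rfl

@[simp] theorem rep_polar (g : G) (a b : A) :
    rep ρ g (polar a b) = polar (ρ g a) (ρ g b) := by
  simp [polar_apply]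

/-- The class of `v(a)` in the coinvariants of `Γ(A)`. -/
def coinvV (a : A) : (rep ρ).Coinvariants := Representation.Coinvariants.mk _ (v a)

/-- The bilinear map `polar` with values in the coinvariants of `Γ(A)`. -/
def coinvPolar : A →+ A →+ (rep ρ).Coinvariants :=
  (AddMonoidHom.compHom (Representation.Coinvariants.mk (rep ρ)).toAddMonoidHom).comp polar

theorem coinvPolar_apply (a b : A) :
    coinvPolar ρ a b = Representation.Coinvariants.mk _ (polar a b) := rfl

theorem coinvPolar_comm (a b : A) : coinvPolar ρ a b = coinvPolar ρ b a := by
  rw [coinvPolar_apply, polar_comm]; rfl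

theorem coinvPolar_self (a : A) : coinvPolar ρ a a = coinvV ρ a + coinvV ρ a := by
  rw [coinvPolar_apply, polar_self, map_add]; rfl

theorem coinvV_add (a b : A) :
    coinvV ρ (a + b) = coinvV ρ a + coinvV ρ b + coinvPolar ρ a b := by
  simp only [coinvV, coinvPolar_apply, v_add, map_add]

theorem coinvV_neg (a : A) : coinvV ρ (-a) = coinvV ρ a := by
  rw [coinvV, v_neg]; rfl

theorem coinvV_smul (g : G) (a : A) : coinvV ρ (ρ g a) = coinvV ρ a := by
  rw [coinvV, ← rep_v]; exact Representation.Coinvariants.mk_self_apply _ _ _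

theorem coinvPolar_smul (g : G) (a b : A) :
    coinvPolar ρ (ρ g a) (ρ g b) = coinvPolar ρ a b := by
  rw [coinvPolar_apply, ← rep_polar]; exact Representation.Coinvariants.mk_self_apply _ _ _

theorem coinvPolar_smul_left (g : G) (a b : A) :
    coinvPolar ρ (ρ g a) b = coinvPolar ρ a (ρ g⁻¹ b) := by
  rw [← coinvPolar_smul ρ g⁻¹]; simp [← Module.End.mul_apply, ← map_mul]

/-- The homomorphism out of the coinvariants of `Γ(A)` given by the quadratic map of an invariant
symmetric bilinear map. -/
def coinvLiftBilin {L : Type*} [AddCommGroup L] (B : A →+ A →+ L)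
    (hB : ∀ g a, B (ρ g a) (ρ g a) = B a a) : (rep ρ).Coinvariants →ₗ[ℤ] L :=
  Representation.Coinvariants.lift _ (liftBilin B).toIntLinearMap fun g =>
    LinearMap.toAddMonoidHom_injective (hom_ext fun a => by simpa using hB g a)

theorem coinvLiftBilin_coinvV {L : Type*} [AddCommGroup L] (B : A →+ A →+ L)
    (hB : ∀ g a, B (ρ g a) (ρ g a) = B a a) (a : A) :
    coinvLiftBilin ρ B hB (coinvV ρ a) = B a a :=
  liftBilin_v B a

theorem coinvLiftBilin_coinvPolar {L : Type*} [AddCommGroup L] (B : A →+ A →+ L)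
    (hB : ∀ g a, B (ρ g a) (ρ g a) = B a a) (a b : A) :
    coinvLiftBilin ρ B hB (coinvPolar ρ a b) = B a b + B b a :=
  liftBilin_polar B a b

/-- A version of `addSubgroup_eq_top` for the coinvariants of `Γ(A)`. -/
theorem addSubgroup_coinvariants_eq_top {S : Set A} (hS : AddSubgroup.closure S = ⊤)
    {P : AddSubgroup (rep ρ).Coinvariants} (hv : ∀ a ∈ S, coinvV ρ a ∈ P)
    (hpolar : ∀ a ∈ S, ∀ b ∈ S, coinvPolar ρ a b ∈ P) : P = ⊤ := by
  have h := addSubgroup_eq_top hS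
    (P := P.comap (Representation.Coinvariants.mk (rep ρ)).toAddMonoidHom) hv hpolar
  rw [eq_top_iff]
  rintro z -
  obtain ⟨z, rfl⟩ := Representation.Coinvariants.mk_surjective _ z
  exact h.ge (AddSubgroup.mem_top z)

end Rep

end WhiteheadGamma

/-- The zeroth Tate homology vanishes if the coinvariants are torsion-free. -/
theorem subsingleton_tateH0 {G A : Type*} [Group G] [Fintype G] [AddCommGroup A]
    (ρ : Representation ℤ G A) (h : ∀ (k : ℕ) (t : ρ.Coinvariants), k ≠ 0 → k • t = 0 → t = 0) :
    Subsingleton (TateH0 ρ) := by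
  refine ⟨fun s t => Subtype.ext ?_⟩
  have key : ∀ s : TateH0 ρ, (s : ρ.Coinvariants) = 0 := fun ⟨s, hs⟩ => by
    obtain ⟨a, rfl⟩ := Representation.Coinvariants.mk_surjective _ s
    have hs' : ρ.norm a = 0 := congrArg Subtype.val (LinearMap.mem_ker.1 hs)
    refine h (Fintype.card G) _ Fintype.card_ne_zero ?_
    have := congrArg (Representation.Coinvariants.mk ρ) hs'
    simpa [Representation.norm, LinearMap.sum_apply] using this
  rw [key s, key t]

namespace DihedralSyzygy

open DihedralGroup MonoidAlgebra

variable {n : ℕ} [NeZero n]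

/-- The values `B(g e_p, e_q)` of an invariant symmetric bilinear form `B` on generators `e₀, e₁, e₂`
of a module over the dihedral group with `N_x e₀ = (1 + xy) e₁` and
`(1 + y) e₂ = (x⁻¹ - 1) e₁`. -/
structure DihedralPairing (n : ℕ) [NeZero n] (L : Type*) [AddCommGroup L] where
  /-- The value `B(g e_p, e_q)`. -/
  val : Fin 3 → Fin 3 → DihedralGroup n → L
  symm : ∀ p q g, val q p g = val p q g⁻¹
  norm_rel : ∀ q g, ∑ k : ZMod n, val 0 q (g * r k) = val 1 q g + val 1 q (g * sr (-1))
  refl_rel : ∀ q g, val 2 q g + val 2 q (g * sr 0) = val 1 q (g * r (-1)) - val 1 q g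

theorem sum_add_left {L : Type*} [AddCommMonoid L] (a : ZMod n) (f : ZMod n → L) :
    ∑ k, f (a + k) = ∑ k, f k :=
  Equiv.sum_comp (Equiv.addLeft a) f

theorem sum_neg {L : Type*} [AddCommMonoid L] (f : ZMod n → L) :
    ∑ k, f (-k) = ∑ k, f k :=
  Equiv.sum_comp (Equiv.neg _) f

theorem sum_sub_left {L : Type*} [AddCommMonoid L] (a : ZMod n) (f : ZMod n → L) :
    ∑ k, f (a - k) = ∑ k, f k :=
  Equiv.sum_comp (Equiv.subLeft a) f

/-- A function on the dihedral group, given on rotations and on reflections. -/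
def onDihedral {L : Type*} (f f' : ZMod n → L) : DihedralGroup n → L
  | r k => f k
  | sr j => f' j

omit [NeZero n] in
@[simp] theorem onDihedral_r {L : Type*} (f f' : ZMod n → L) (k : ZMod n) :
    onDihedral f f' (r k) = f k := rfl

omit [NeZero n] in
@[simp] theorem onDihedral_sr {L : Type*} (f f' : ZMod n → L) (k : ZMod n) :
    onDihedral f f' (sr k) = f' k := rfl

/-- Functions on the rotations (and one function on the reflections) that determine a
`DihedralPairing`. -/
structure PairingData (n : ℕ) [NeZero n] (L : Type*) [AddCommGroup L] where
  /-- The values `B(x^k e_p, e_p)`. -/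
  diag : Fin 3 → ZMod n → L
  /-- The values `B(g e₀, e₀)` for reflections `g`. -/
  refl : ZMod n → L
  /-- The values `B(x^k e₁, e₀)`. -/
  β : ZMod n → L
  /-- The values `B(x^k e₁, e₂)`. -/
  γ : ZMod n → L
  /-- The values `B(x^k e₀, e₂)`. -/
  δ : ZMod n → L
  diag_neg : ∀ p k, diag p (-k) = diag p k
  sum_refl : ∑ k, refl k = ∑ k, diag 0 k
  sum_β : ∑ k, β k = (n / 2) • ∑ k, diag 0 k
  sum_δ : ∑ k, δ k = 0
  γ_add_diag : ∀ k, γ (-k) + diag 1 k = γ (k - 1) + diag 1 (k - 1)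

namespace PairingData

variable {L : Type*} [AddCommGroup L] (D : PairingData n L)

/-- The values of the pairing determined by `D`. -/
def val (p q : Fin 3) : DihedralGroup n → L :=
  !![onDihedral (D.diag 0) D.refl,
      onDihedral (fun k => D.β (-k)) fun j => ∑ k, D.diag 0 k - D.β (-j - 1),
      onDihedral D.δ fun j => D.β (-j - 1) - D.β (-j) - D.δ j;
    onDihedral D.β fun j => ∑ k, D.diag 0 k - D.β (-j - 1),
      onDihedral (D.diag 1) fun j => (n / 2) • ∑ k, D.diag 0 k - D.diag 1 (-j - 1),
      onDihedral D.γ fun j => -D.γ (-j - 1);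
    onDihedral (fun k => D.δ (-k)) fun j => D.β (-j - 1) - D.β (-j) - D.δ j,
      onDihedral (fun k => D.γ (-k)) fun j => -D.γ (-j - 1),
      onDihedral (D.diag 2) fun j => D.γ (-j - 1) - D.γ (-j) - D.diag 2 j] p q

/-- The pairing determined by `D`. -/
def toPairing (hn : Even n) : DihedralPairing n L where
  val := D.val
  symm p q g := by
    rcases g with k | j <;> fin_cases p <;> fin_cases q <;> simp [val, D.diag_neg]
  norm_rel q g := by
    have hn' : n • ∑ k, D.diag 0 k = (n / 2) • ∑ k, D.diag 0 k + (n / 2) • ∑ k, D.diag 0 k := by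
      rw [← add_smul]; congr 1; obtain ⟨m, rfl⟩ := hn; omega
    have hneg : ∀ a : ZMod n, -1 - a = -a - 1 := fun a => by ring
    rcases g with a | a
    · fin_cases q
      · simp [val, sum_add_left a (D.diag 0)]
      · simp [val, ← sub_eq_neg_add, sum_sub_left (-a) D.β, D.sum_β]
      · simp [val, sum_add_left a D.δ, D.sum_δ]
    · fin_cases q
      · simp [val, sum_add_left a D.refl, D.sum_refl, hneg]
      · have h : ∀ k : ZMod n, -k + -a - 1 = (-a - 1) - k := fun k => by ring
        simp [val, h, sum_sub_left (-a - 1) D.β, D.sum_β, hneg, hn']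
      · have h : ∀ k : ZMod n, -a - k - 1 = (-a - 1) - k := fun k => by ring
        have h' : ∀ k : ZMod n, -k + -a = -a - k := fun k => by ring
        simp [val, h, h', sum_sub_left (-a - 1) D.β, sum_sub_left (-a) D.β,
          sum_add_left a D.δ, D.sum_δ, hneg]
  refl_rel q g := by
    rcases g with a | a
    · fin_cases q
      · simp [val, sub_eq_add_neg]
      · have h := D.γ_add_diag a
        simp only [val, r_mul_sr, r_mul_r, Matrix.of_apply, Matrix.cons_val, onDihedral_r,
          onDihedral_sr, Fin.reduceFinMk, zero_sub, neg_neg, ← sub_eq_add_neg]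
        rw [sub_eq_sub_iff_add_eq_add, h, add_comm]
      · simp [val, D.diag_neg, sub_eq_add_neg]
    · fin_cases q
      · simp [val]
      · have h := D.γ_add_diag (-a)
        have h' := D.diag_neg 1 a
        simp only [neg_neg, D.diag_neg] at h
        simp [val, D.diag_neg]
        rw [neg_add_eq_iff_eq_add, ← add_sub_assoc, eq_sub_iff_add_eq, h]
      · simp [val, D.diag_neg]
        abel

end PairingData

namespace DihedralPairing

variable {L : Type*} [AddCommGroup L] (P : DihedralPairing n L)

theorem val_neg_r (p : Fin 3) (k : ZMod n) : P.val p p (r (-k)) = P.val p p (r k) := by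
  rw [P.symm p p, inv_r, neg_neg]

theorem val_symm_sr (p q : Fin 3) (j : ZMod n) : P.val q p (sr j) = P.val p q (sr j) := by
  rw [P.symm p q, inv_sr]

theorem norm_rel_r (q : Fin 3) (a : ZMod n) :
    ∑ k, P.val 0 q (r k) = P.val 1 q (r a) + P.val 1 q (sr (-1 - a)) := by
  simpa [sum_add_left a fun k => P.val 0 q (r k)] using P.norm_rel q (r a)

theorem norm_rel_sr (q : Fin 3) (a : ZMod n) :
    ∑ k, P.val 0 q (sr k) = P.val 1 q (sr a) + P.val 1 q (r (-1 - a)) := by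
  simpa [sum_add_left a fun k => P.val 0 q (sr k)] using P.norm_rel q (sr a)

theorem sum_val_sr (q : Fin 3) : ∑ k, P.val 0 q (sr k) = ∑ k, P.val 0 q (r k) := by
  rw [P.norm_rel_r q 0, P.norm_rel_sr q (-1), sub_self, sub_zero, add_comm]

theorem val_one_sr (q : Fin 3) (j : ZMod n) :
    P.val 1 q (sr j) = ∑ k, P.val 0 q (r k) - P.val 1 q (r (-j - 1)) := by
  rw [P.norm_rel_r q (-j - 1), show -1 - (-j - 1) = j by ring, add_sub_cancel_left]

theorem val_two_sr (q : Fin 3) (j : ZMod n) :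
    P.val 2 q (sr j) = P.val 1 q (r (-j - 1)) - P.val 1 q (r (-j)) - P.val 2 q (r (-j)) := by
  have h := P.refl_rel q (r (-j))
  simp only [r_mul_sr, r_mul_r, zero_sub, neg_neg, ← sub_eq_add_neg] at h
  rw [← h, add_sub_cancel_left]

theorem sum_val_zero_one : ∑ k, P.val 0 1 (r k) = ∑ k, P.val 1 0 (r k) := by
  rw [← sum_neg]
  exact Finset.sum_congr rfl fun k _ => by rw [P.symm 1 0, inv_r, neg_neg]

theorem val_one_two_add (h : ∑ k, P.val 0 2 (r k) = 0) (k : ZMod n) :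
    P.val 1 2 (r (-k)) + P.val 1 1 (r k) = P.val 1 2 (r (k - 1)) + P.val 1 1 (r (k - 1)) := by
  have h1 := P.refl_rel 1 (r k)
  rw [P.symm 1 2, r_mul_sr, P.val_symm_sr 1 2, val_one_sr, h] at h1
  simp only [inv_r, r_mul_r, zero_sub, neg_neg, ← sub_eq_add_neg] at h1
  rw [sub_eq_sub_iff_add_eq_add] at h1
  rw [h1, add_comm]

/-- `∑ B(x^k e₀, e₂)` vanishes once one instance of `val_one_two_add` is known. -/
theorem sum_val_zero_two
    (h : P.val 1 2 (r (-1)) - P.val 1 2 (r 0) = P.val 1 1 (r 0) - P.val 1 1 (r 1)) :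
    ∑ k, P.val 0 2 (r k) = 0 := by
  have h1 := P.refl_rel 1 (r 1)
  rw [P.symm 1 2, r_mul_sr, P.val_symm_sr 1 2, val_one_sr] at h1
  simp only [inv_r, r_mul_r, zero_sub, neg_neg, sub_self, add_neg_cancel] at h1
  rw [← h, ← sub_eq_zero] at h1
  rw [← h1]
  abel

/-- The restriction of a pairing to the data that determine it. -/
def toData (hβ : ∑ k, P.val 1 0 (r k) = (n / 2) • ∑ k, P.val 0 0 (r k))
    (hδ : ∑ k, P.val 0 2 (r k) = 0) : PairingData n L where
  diag p k := P.val p p (r k)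
  refl j := P.val 0 0 (sr j)
  β k := P.val 1 0 (r k)
  γ k := P.val 1 2 (r k)
  δ k := P.val 0 2 (r k)
  diag_neg := P.val_neg_r
  sum_refl := P.sum_val_sr 0
  sum_β := hβ
  sum_δ := hδ
  γ_add_diag := P.val_one_two_add hδ

theorem toData_val (hβ : ∑ k, P.val 1 0 (r k) = (n / 2) • ∑ k, P.val 0 0 (r k))
    (hδ : ∑ k, P.val 0 2 (r k) = 0) : (P.toData hβ hδ).val = P.val := by
  have h02 : ∀ j, P.val 2 0 (sr j) =
      P.val 1 0 (r (-j - 1)) - P.val 1 0 (r (-j)) - P.val 0 2 (r j) := fun j => by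
    rw [val_two_sr, P.symm 0 2, inv_r, neg_neg]
  have h22 : ∀ j, P.val 2 2 (sr j) =
      P.val 1 2 (r (-j - 1)) - P.val 1 2 (r (-j)) - P.val 2 2 (r j) := fun j => by
    rw [val_two_sr, P.val_neg_r]
  have h12 : ∀ j, P.val 1 2 (sr j) = -P.val 1 2 (r (-j - 1)) := fun j => by
    rw [val_one_sr, hδ, zero_sub]
  have h11 : ∀ j, P.val 1 1 (sr j) =
      (n / 2) • ∑ k, P.val 0 0 (r k) - P.val 1 1 (r (-j - 1)) := fun j => by
    rw [val_one_sr, sum_val_zero_one, hβ]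
  funext p q g
  rcases g with k | j
  · fin_cases p <;> fin_cases q <;> simp [PairingData.val, toData, P.symm 0 1, P.symm 0 2, P.symm 1 2]
  · have h01 := P.val_symm_sr 1 0 j
    have h20 := P.val_symm_sr 2 0 j
    have h21 := P.val_symm_sr 1 2 j
    fin_cases p <;> fin_cases q <;>
      simp [PairingData.val, toData, h01, h20, h21, h02, h22, h12, h11, P.val_one_sr 0]

end DihedralPairing

namespace PairingData

variable {L L' : Type*} [AddCommGroup L] [AddCommGroup L'] (D : PairingData n L)
  (D' : PairingData n L')

/-- A homomorphism that is compatible with the data is compatible with the pairings. -/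
theorem map_val (f : L →+ L') (hdiag : ∀ p k, f (D.diag p k) = D'.diag p k)
    (hrefl : ∀ k, f (D.refl k) = D'.refl k) (hβ : ∀ k, f (D.β k) = D'.β k)
    (hγ : ∀ k, f (D.γ k) = D'.γ k) (hδ : ∀ k, f (D.δ k) = D'.δ k)
    (p q : Fin 3) (g : DihedralGroup n) : f (D.val p q g) = D'.val p q g := by
  rcases g with k | j <;> fin_cases p <;> fin_cases q <;>
    simp [val, hdiag, hrefl, hβ, hγ, hδ]

theorem val_one (p : Fin 3) : D.val p p 1 = D.diag p 0 := by
  fin_cases p <;> rfl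

end PairingData

/-- A representative of the orbit of `k` under an involution `σ`. -/
def orbitRep (σ : ZMod n → ZMod n) (k : ZMod n) : ZMod n :=
  if k.val ≤ (σ k).val then k else σ k

theorem orbitRep_apply {σ : ZMod n → ZMod n} (hσ : Function.Involutive σ) (k : ZMod n) :
    orbitRep σ (σ k) = orbitRep σ k := by
  unfold orbitRep
  rw [hσ k]
  split_ifs with h h' h'
  · exact ZMod.val_injective n (le_antisymm h h')
  · rfl
  · rfl
  · omega

omit [NeZero n] in
theorem apply_orbitRep {σ : ZMod n → ZMod n} {X : Type*} (f : ZMod n → X)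
    (hf : ∀ k, f (σ k) = f k) (k : ZMod n) : f (orbitRep σ k) = f k := by
  unfold orbitRep
  split_ifs
  · rfl
  · exact hf k

/-- Generators of the universal target of an invariant quadratic form. -/
inductive Symbol (n : ℕ) : Type
  | diag (p : Fin 3) (k : ZMod n)
  | refl (k : ZMod n)
  | β (k : ZMod n)
  | κ (k : ZMod n)
  | δ (k : ZMod n)

namespace Symbol

/-- The free abelian group on the symbols. -/
abbrev Free (n : ℕ) : Type := Symbol n →₀ ℤ

/-- The basis element of a symbol. -/
noncomputable def single (s : Symbol n) : Free n := Finsupp.single s 1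

/-- The homomorphism with prescribed values on the symbols. -/
noncomputable def lift {L : Type*} [AddCommGroup L] (f : Symbol n → L) : Free n →+ L :=
  (Finsupp.linearCombination ℤ f).toAddMonoidHom

omit [NeZero n] in
@[simp] theorem lift_single {L : Type*} [AddCommGroup L] (f : Symbol n → L) (s : Symbol n) :
    lift f (single s) = f s := by
  simp [lift, single]

/-- Change the value of `f` at zero so that the sum of all values becomes `a`. -/
def adjust {L : Type*} [AddCommGroup L] (f : ZMod n → L) (a : L) (k : ZMod n) : L :=
  f k + if k = 0 then a - ∑ i, f i else 0

theorem sum_adjust {L : Type*} [AddCommGroup L] (f : ZMod n → L) (a : L) :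
    ∑ k, adjust f a k = a := by
  simp [adjust, Finset.sum_add_distrib]

theorem map_adjust {L L' : Type*} [AddCommGroup L] [AddCommGroup L'] (φ : L →+ L')
    {f : ZMod n → L} {a : L} {f' : ZMod n → L'} (hf : ∀ k, φ (f k) = f' k)
    (ha : ∑ i, f' i = φ a) (k : ZMod n) : φ (adjust f a k) = f' k := by
  rw [adjust, map_add, hf, apply_ite φ, map_sub, map_sum]
  simp [hf, ha]

/-- The universal diagonal values. -/
noncomputable def diagVal (p : Fin 3) (k : ZMod n) : Free n :=
  if k = 0 then single (diag p 0) + single (diag p 0) else single (diag p (orbitRep Neg.neg k))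

/-- The universal pairing data. -/
noncomputable def data (n : ℕ) [NeZero n] : PairingData n (Free n) where
  diag := diagVal
  refl := adjust (fun k => single (refl k)) (∑ k, diagVal 0 k)
  β := adjust (fun k => single (β k)) ((n / 2) • ∑ k, diagVal 0 k)
  γ k := single (κ (orbitRep (fun i => -1 - i) k)) - diagVal 1 k
  δ := adjust (fun k => single (δ k)) 0
  diag_neg p k := by
    simp only [diagVal, neg_eq_zero, orbitRep_apply neg_involutive]
  sum_refl := sum_adjust _ _
  sum_β := sum_adjust _ _
  sum_δ := sum_adjust _ _
  γ_add_diag k := by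
    have h := orbitRep_apply (n := n) (σ := fun i => -1 - i) (fun i => by ring) (-k)
    rw [show -1 - -k = k - 1 by ring] at h
    have h' : diagVal 1 (-k) = diagVal (n := n) 1 k := by
      simp only [diagVal, neg_eq_zero, orbitRep_apply neg_involutive]
    rw [← h, h', sub_add_cancel, sub_add_cancel]

/-- The values on the symbols determined by pairing data and halves of the diagonal values. -/
def ofData {L : Type*} [AddCommGroup L] (D : PairingData n L) (h : Fin 3 → L) : Symbol n → L
  | diag p k => if k = 0 then h p else D.diag p k
  | refl k => D.refl k
  | β k => D.β k
  | κ k => D.γ k + D.diag 1 k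
  | δ k => D.δ k

theorem lift_ofData_val {L : Type*} [AddCommGroup L] (D : PairingData n L) (h : Fin 3 → L)
    (hh : ∀ p, h p + h p = D.diag p 0) (p q : Fin 3) (g : DihedralGroup n) :
    lift (ofData D h) ((data n).val p q g) = D.val p q g := by
  have hdiag : ∀ p k, lift (ofData D h) (diagVal p k) = D.diag p k := by
    intro p k
    unfold diagVal
    split_ifs with hk
    · simp [ofData, hk, hh]
    · have h0 : orbitRep Neg.neg k ≠ 0 := by
        unfold orbitRep; split_ifs <;> simpa using hk
      simp [ofData, h0, apply_orbitRep (D.diag p) (D.diag_neg p)]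
  have hκ : ∀ k, D.γ (-1 - k) + D.diag 1 (-1 - k) = D.γ k + D.diag 1 k := by
    intro k
    have := D.γ_add_diag (-k)
    rw [neg_neg, D.diag_neg, show -k - 1 = -1 - k by ring] at this
    exact this.symm
  refine PairingData.map_val _ _ _ hdiag ?_ ?_ ?_ ?_ p q g
  · exact map_adjust _ (fun k => lift_single _ _) (by simp [D.sum_refl, hdiag])
  · exact map_adjust _ (fun k => lift_single _ _) (by simp [D.sum_β, hdiag])
  · intro k
    simp only [data, map_sub, lift_single, hdiag]
    rw [ofData, apply_orbitRep (fun k => D.γ k + D.diag 1 k) hκ, add_sub_cancel_right]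
  · exact map_adjust _ (fun k => lift_single _ _) (by simp [D.sum_δ])

theorem lift_ofData_diag {L : Type*} [AddCommGroup L] (D : PairingData n L) (h : Fin 3 → L)
    (p : Fin 3) : lift (ofData D h) (single (diag p 0)) = h p := by
  simp [ofData]

theorem data_val_one (p : Fin 3) :
    (data n).val p p 1 = single (diag p 0) + single (diag p 0) := by
  rw [PairingData.val_one]
  simp [data, diagVal]

end Symbol

/-- The additive extension of a function on the dihedral group to its group ring. -/
noncomputable def linExt {L : Type*} [AddCommGroup L] (f : DihedralGroup n → L) : R n →+ L :=
  (Finsupp.liftAddHom fun g => zmultiplesHom L (f g)).comp coeffAddEquiv.toAddMonoidHom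

omit [NeZero n] in
@[simp] theorem linExt_single {L : Type*} [AddCommGroup L] (f : DihedralGroup n → L)
    (g : DihedralGroup n) (a : ℤ) : linExt f (single g a) = a • f g := by
  simp [linExt]

omit [NeZero n] in
theorem linExt_bar {L : Type*} [AddCommGroup L] (f : DihedralGroup n → L) (a : R n) :
    linExt f (bar n a) = linExt (fun g => f g⁻¹) a := by
  induction a using MonoidAlgebra.induction_linear with
  | zero => simp
  | add a b ha hb => simp [ha, hb]
  | single g a => simp

/-- Coordinates with respect to the basis `e₁, -e₂, e₃ - e₁` of `ℤπ³`. -/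
noncomputable def coord (n : ℕ) : (Fin 3 → R n) →ₗ[R n] (Fin 3 → R n) where
  toFun u := ![u 0 + u 2, -u 1, u 2]
  map_add' u w := by
    ext i : 1
    fin_cases i <;> simp [add_add_add_comm, add_comm]
  map_smul' a u := by
    ext i : 1
    fin_cases i <;> simp [mul_add]

omit [NeZero n] in
theorem coord_apply (u : Fin 3 → R n) : coord n u = ![u 0 + u 2, -u 1, u 2] := rfl

/-- The basis `e₁, -e₂, e₃ - e₁` of `ℤπ³`. -/
noncomputable def gen (n : ℕ) : Fin 3 → Fin 3 → R n :=
  ![![1, 0, 0], ![0, -1, 0], ![-1, 0, 1]]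

omit [NeZero n] in
theorem coord_gen (p : Fin 3) : coord n (gen n p) = Pi.single p 1 := by
  ext i : 1
  fin_cases p <;> fin_cases i <;> simp [coord_apply, gen]

omit [NeZero n] in
theorem sum_coord_smul_gen (u : Fin 3 → R n) : ∑ p, coord n u p • gen n p = u := by
  ext i : 1
  fin_cases i <;> simp [coord_apply, gen, Fin.sum_univ_three]

omit [NeZero n] in
theorem dUp2_apply (u : Fin 2 → R n) :
    dUp2 n u = ![u 0 * bar n (Nx n) - u 1 * bar n (1 + y n),
      u 0 * bar n (1 + x n * y n) + u 1 * bar n (x n - 1), u 1 * bar n (1 + y n)] := by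
  ext i : 1
  fin_cases i
  · change Matrix.vecMul u _ 0 = _
    simp [d2Matrix, Matrix.vecMul, dotProduct, Fin.sum_univ_two, mul_add, sub_eq_add_neg, add_comm]
  · change Matrix.vecMul u _ 1 = _
    simp [d2Matrix, Matrix.vecMul, dotProduct, Fin.sum_univ_two]
  · change Matrix.vecMul u _ 2 = _
    simp [d2Matrix, Matrix.vecMul, dotProduct, Fin.sum_univ_two, mul_add, add_comm]

omit [NeZero n] in
theorem coord_dUp2 (u : Fin 2 → R n) :
    coord n (dUp2 n u) = ![u 0 * bar n (Nx n), -(u 0 * bar n (1 + x n * y n)) -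
      u 1 * bar n (x n - 1), u 1 * bar n (1 + y n)] := by
  rw [coord_apply, dUp2_apply]
  simp [neg_add_eq_sub]

theorem bar_Nx : bar n (Nx n) = Nx n := by
  simp only [Nx_eq, bar_sum, bar_single, inv_r]
  exact sum_neg fun k => single (r k) (1 : ℤ)

namespace DihedralPairing

variable {L : Type*} [AddCommGroup L] (P : DihedralPairing n L)

/-- The additive extension of `P.val p q` to the group ring. -/
noncomputable def lin (p q : Fin 3) : R n →+ L := linExt (P.val p q)

theorem lin_bar (p q : Fin 3) (a : R n) : P.lin p q (bar n a) = P.lin q p a := by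
  rw [lin, linExt_bar, lin]
  exact congrArg (linExt · a) (funext fun g => (P.symm p q g).symm)

theorem lin_mul_Nx (q : Fin 3) (a : R n) :
    P.lin 0 q (a * bar n (Nx n)) = P.lin 1 q (a * bar n (1 + x n * y n)) := by
  rw [bar_Nx, Nx_eq]
  induction a using MonoidAlgebra.induction_linear with
  | zero => simp
  | add a b ha hb => simp only [add_mul, map_add, ha, hb]
  | single g a =>
    have := congrArg (a • ·) (P.norm_rel q g)
    simpa [lin, Finset.mul_sum, mul_add, x_eq, y_eq, MonoidAlgebra.one_def, Finset.smul_sum]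
      using this

theorem lin_mul_one_add_y (q : Fin 3) (a : R n) :
    P.lin 2 q (a * bar n (1 + y n)) = P.lin 1 q (a * bar n (x n - 1)) := by
  induction a using MonoidAlgebra.induction_linear with
  | zero => simp
  | add a b ha hb => simp only [add_mul, map_add, ha, hb]
  | single g a =>
    have := congrArg (a • ·) (P.refl_rel q g)
    simpa [lin, mul_add, mul_sub, smul_sub, x_eq, y_eq, MonoidAlgebra.one_def] using this

/-- The invariant symmetric bilinear form on `ℤπ³` determined by a pairing. -/
noncomputable def form : (Fin 3 → R n) →+ (Fin 3 → R n) →+ L :=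
  AddMonoidHom.mk' (fun u => AddMonoidHom.mk'
      (fun w => ∑ p, ∑ q, P.lin p q (bar n (coord n w q) * coord n u p))
      fun w w' => by simp [add_mul, Finset.sum_add_distrib])
    fun u u' => by ext w; simp [mul_add, Finset.sum_add_distrib]

theorem form_apply (u w : Fin 3 → R n) :
    P.form u w = ∑ p, ∑ q, P.lin p q (bar n (coord n w q) * coord n u p) := rfl

theorem form_comm (u w : Fin 3 → R n) : P.form u w = P.form w u := by
  rw [form_apply, form_apply, Finset.sum_comm]
  refine Finset.sum_congr rfl fun p _ => Finset.sum_congr rfl fun q _ => ?_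
  rw [← P.lin_bar p q]
  simp

theorem form_smul_left (a : R n) (u w : Fin 3 → R n) :
    P.form (a • u) w = P.form u (bar n a • w) := by
  simp [form_apply, mul_assoc]

theorem form_smul_gen (p q : Fin 3) (g : DihedralGroup n) :
    P.form (single g (1 : ℤ) • gen n p) (gen n q) = P.val p q g := by
  rw [form_apply, Finset.sum_eq_single p, Finset.sum_eq_single q] <;>
    simp +contextual [coord_gen, lin, MonoidAlgebra.one_def]

theorem form_dUp2 (u : Fin 2 → R n) (w : Fin 3 → R n) : P.form (dUp2 n u) w = 0 := by
  rw [form_apply, Finset.sum_comm]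
  refine Finset.sum_eq_zero fun q _ => ?_
  simp only [coord_dUp2, Fin.sum_univ_three, Matrix.cons_val_zero, Matrix.cons_val_one,
    Matrix.cons_val, mul_sub, mul_neg, map_sub, map_neg, ← mul_assoc, lin_mul_Nx,
    lin_mul_one_add_y]
  abel

theorem form_eq_of_mk_eq {u u' : Fin 3 → R n}
    (h : (Submodule.Quotient.mk u : Coker n) = Submodule.Quotient.mk u') (w : Fin 3 → R n) :
    P.form u w = P.form u' w := by
  obtain ⟨v, hv⟩ := (Submodule.Quotient.eq _).1 h
  rw [← sub_eq_zero, ← AddMonoidHom.sub_apply, ← map_sub, ← hv, form_dUp2]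

/-- The value of the form on `coker d²` determined by a pairing. -/
noncomputable def cokerFormFun (a b : Coker n) : L :=
  P.form (Function.surjInv (Submodule.Quotient.mk_surjective _) a)
    (Function.surjInv (Submodule.Quotient.mk_surjective _) b)

theorem cokerFormFun_mk (u w : Fin 3 → R n) :
    P.cokerFormFun (Submodule.Quotient.mk u) (Submodule.Quotient.mk w) = P.form u w := by
  rw [cokerFormFun, P.form_eq_of_mk_eq (Function.surjInv_eq _ _), form_comm,
    P.form_eq_of_mk_eq (Function.surjInv_eq _ _), form_comm]

/-- The invariant symmetric bilinear form on `coker d²` determined by a pairing. -/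
noncomputable def cokerForm : Coker n →+ Coker n →+ L :=
  AddMonoidHom.mk' (fun a => AddMonoidHom.mk' (P.cokerFormFun a) fun b c => by
      obtain ⟨u, rfl⟩ := Submodule.Quotient.mk_surjective _ a
      obtain ⟨v, rfl⟩ := Submodule.Quotient.mk_surjective _ b
      obtain ⟨w, rfl⟩ := Submodule.Quotient.mk_surjective _ c
      simp only [← Submodule.Quotient.mk_add, cokerFormFun_mk, map_add])
    fun a b => by
      ext c
      obtain ⟨u, rfl⟩ := Submodule.Quotient.mk_surjective _ a
      obtain ⟨v, rfl⟩ := Submodule.Quotient.mk_surjective _ b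
      obtain ⟨w, rfl⟩ := Submodule.Quotient.mk_surjective _ c
      simp only [← Submodule.Quotient.mk_add, cokerFormFun_mk, map_add, AddMonoidHom.mk'_apply,
        AddMonoidHom.add_apply]

theorem cokerForm_mk (u w : Fin 3 → R n) :
    P.cokerForm (Submodule.Quotient.mk u) (Submodule.Quotient.mk w) = P.form u w :=
  P.cokerFormFun_mk u w

theorem cokerForm_comm (a b : Coker n) : P.cokerForm a b = P.cokerForm b a := by
  obtain ⟨u, rfl⟩ := Submodule.Quotient.mk_surjective _ a
  obtain ⟨w, rfl⟩ := Submodule.Quotient.mk_surjective _ b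
  rw [cokerForm_mk, cokerForm_mk, form_comm]

theorem cokerForm_rep (g : DihedralGroup n) (a b : Coker n) :
    P.cokerForm (cokerRep n g a) (cokerRep n g b) = P.cokerForm a b := by
  obtain ⟨u, rfl⟩ := Submodule.Quotient.mk_surjective _ a
  obtain ⟨w, rfl⟩ := Submodule.Quotient.mk_surjective _ b
  rw [cokerRep_apply, cokerRep_apply, ← Submodule.Quotient.mk_smul, ← Submodule.Quotient.mk_smul,
    cokerForm_mk, cokerForm_mk, form_smul_left, smul_smul]
  simp [← MonoidAlgebra.one_def]

end DihedralPairing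

/-- The generators of `coker d²` given by the basis `gen`. -/
noncomputable def cokerGen (n : ℕ) (p : Fin 3) : Coker n := Submodule.Quotient.mk (gen n p)

theorem DihedralPairing.cokerForm_gen {L : Type*} [AddCommGroup L] (P : DihedralPairing n L)
    (p q : Fin 3) (g : DihedralGroup n) :
    P.cokerForm (cokerRep n g (cokerGen n p)) (cokerGen n q) = P.val p q g := by
  rw [cokerRep_apply, cokerGen, cokerGen, ← Submodule.Quotient.mk_smul, cokerForm_mk,
    form_smul_gen]

omit [NeZero n] in
theorem closure_cokerGen :
    AddSubgroup.closure {a | ∃ g p, a = cokerRep n g (cokerGen n p)} = ⊤ := by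
  rw [eq_top_iff]
  rintro a -
  obtain ⟨u, rfl⟩ := Submodule.Quotient.mk_surjective _ a
  rw [← sum_coord_smul_gen u, ← Submodule.mkQ_apply, map_sum]
  refine sum_mem fun p _ => ?_
  induction coord n u p using MonoidAlgebra.induction_linear with
  | zero => simp
  | add a b ha hb => rw [add_smul, map_add]; exact add_mem ha hb
  | single g a =>
    have : single g a • gen n p = a • (single g (1 : ℤ) • gen n p) := by
      rw [← smul_assoc, smul_single, smul_eq_mul, mul_one]
    rw [this, map_zsmul]
    refine zsmul_mem (AddSubgroup.subset_closure (Set.mem_ofPred.2 ⟨g, p, ?_⟩)) a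
    rw [cokerRep_apply]
    rfl

omit [NeZero n] in
theorem mk_dUp2 (u : Fin 2 → R n) : (Submodule.Quotient.mk (dUp2 n u) : Coker n) = 0 :=
  (Submodule.Quotient.mk_eq_zero _).2 (LinearMap.mem_range_self _ u)

/-- `N_x e₀ = (1 + xy) e₁`. -/
theorem norm_cokerGen :
    ∑ k, cokerRep n (r k) (cokerGen n 0) = cokerGen n 1 + cokerRep n (sr (-1)) (cokerGen n 1) := by
  rw [← sub_eq_zero, ← mk_dUp2 ![1, 0]]
  simp only [cokerRep_apply, cokerGen, ← Submodule.mkQ_apply, ← map_smul, ← map_sum, ← map_add,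
    ← map_sub, ← Finset.sum_smul, ← Nx_eq]
  congr 1
  rw [dUp2_apply, bar_Nx]
  ext i : 1
  fin_cases i <;> simp [gen, x_eq, y_eq, add_comm]

omit [NeZero n] in
/-- `(1 + y) e₂ = (x⁻¹ - 1) e₁`. -/
theorem refl_cokerGen :
    cokerGen n 2 + cokerRep n (sr 0) (cokerGen n 2) =
      cokerRep n (r (-1)) (cokerGen n 1) - cokerGen n 1 := by
  rw [← sub_eq_zero, ← mk_dUp2 ![0, 1]]
  simp only [cokerRep_apply, cokerGen, ← Submodule.mkQ_apply, ← map_smul, ← map_add, ← map_sub]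
  congr 1
  rw [dUp2_apply]
  ext i : 1
  fin_cases i <;> simp [gen, x_eq, y_eq] <;> abel

open WhiteheadGamma

/-- The universal pairing on `coker d²`. -/
noncomputable def univPairing (n : ℕ) [NeZero n] :
    DihedralPairing n (rep (cokerRep n)).Coinvariants where
  val p q g := coinvPolar (cokerRep n) (cokerRep n g (cokerGen n p)) (cokerGen n q)
  symm p q g := by rw [coinvPolar_smul_left, coinvPolar_comm]
  norm_rel q g := by
    have h := congrArg (fun a => coinvPolar (cokerRep n) (cokerRep n g a) (cokerGen n q))
      (norm_cokerGen (n := n))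
    simpa only [map_sum, map_add, map_mul, Module.End.mul_apply, AddMonoidHom.add_apply,
      AddMonoidHom.finsetSum_apply] using h
  refl_rel q g := by
    have h := congrArg (fun a => coinvPolar (cokerRep n) (cokerRep n g a) (cokerGen n q))
      (refl_cokerGen (n := n))
    simpa only [map_sub, map_add, map_mul, Module.End.mul_apply, AddMonoidHom.add_apply,
      AddMonoidHom.sub_apply] using h

omit [NeZero n] in
theorem cokerRep_cokerRep (g h : DihedralGroup n) (a : Coker n) :
    cokerRep n g (cokerRep n h a) = cokerRep n (g * h) a := by
  rw [map_mul, Module.End.mul_apply]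

theorem univPairing_val (p q : Fin 3) (g : DihedralGroup n) : (univPairing n).val p q g =
    coinvPolar (cokerRep n) (cokerRep n g (cokerGen n p)) (cokerGen n q) := rfl

theorem univPairing_val_one (p : Fin 3) : (univPairing n).val p p 1 =
    coinvV (cokerRep n) (cokerGen n p) + coinvV (cokerRep n) (cokerGen n p) := by
  rw [univPairing_val, map_one, Module.End.one_apply, coinvPolar_self]

theorem coinvV_sum_rotations (hn : Even n) (a : Coker n) :
    coinvV (cokerRep n) (∑ k, cokerRep n (r k) a) =
      (n / 2) • ∑ k, coinvPolar (cokerRep n) (cokerRep n (r k) a) a := by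
  have hm : n = n / 2 + n / 2 := by obtain ⟨m, hm⟩ := hn; omega
  generalize n / 2 = m at hm
  set N := ∑ k, cokerRep n (r k) a with hN
  set w := ∑ i ∈ Finset.range m, cokerRep n (r (i : ZMod n)) a with hw
  have hNw : N = w + cokerRep n (r (m : ZMod n)) w := by
    rw [hN, sum_zmod_eq_sum_range, hw, map_sum, congrArg Finset.range hm, Finset.sum_range_add]
    congr 1
    refine Finset.sum_congr rfl fun i _ => ?_
    rw [cokerRep_cokerRep, r_mul_r, Nat.cast_add]
  have hfix : ∀ k : ZMod n, cokerRep n (r k) N = N := fun k => by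
    rw [hN, map_sum]
    simp only [cokerRep_cokerRep, r_mul_r]
    exact sum_add_left k fun i => cokerRep n (r i) a
  calc coinvV (cokerRep n) N = coinvPolar (cokerRep n) w N := by
        rw [hNw, coinvV_add, coinvV_smul, ← coinvPolar_self, map_add]
    _ = ∑ i ∈ Finset.range m, coinvPolar (cokerRep n) a N := by
        rw [hw, map_sum (coinvPolar (cokerRep n)), AddMonoidHom.finsetSum_apply]
        exact Finset.sum_congr rfl fun i _ => by rw [coinvPolar_smul_left, inv_r, hfix]
    _ = _ := by
        rw [Finset.sum_const, Finset.card_range, coinvPolar_comm, hN, map_sum,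
          AddMonoidHom.finsetSum_apply]

theorem univPairing_sum_one_zero (hn : Even n) :
    ∑ k, (univPairing n).val 1 0 (r k) = (n / 2) • ∑ k, (univPairing n).val 0 0 (r k) := by
  have h := coinvV_sum_rotations hn (cokerGen n 0)
  rw [norm_cokerGen, coinvV_add, coinvV_smul, ← univPairing_val_one, coinvPolar_comm,
    ← univPairing_val] at h
  rw [← DihedralPairing.sum_val_zero_one, DihedralPairing.norm_rel_r _ 1 0, sub_zero, r_zero, h]
  rfl

theorem univPairing_sum_zero_two : ∑ k, (univPairing n).val 0 2 (r k) = 0 := by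
  refine (univPairing n).sum_val_zero_two ?_
  have h := congrArg (coinvV (cokerRep n)) (refl_cokerGen (n := n))
  rw [coinvV_add, coinvV_smul, ← univPairing_val_one, coinvPolar_comm, ← univPairing_val,
    sub_eq_add_neg, coinvV_add, coinvV_neg, coinvV_smul, ← univPairing_val_one, map_neg,
    ← univPairing_val] at h
  have h2 := (univPairing n).refl_rel 2 1
  simp only [one_mul] at h2
  rw [r_zero, ← h2, h, ← DihedralPairing.val_neg_r _ 1 1, sub_eq_add_neg]

/-- The coinvariants of `Γ(coker d²)` are torsion-free. -/
theorem coinvariants_torsionFree (hn : Even n) (k : ℕ)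
    (t : (rep (cokerRep n)).Coinvariants) (hk : k ≠ 0) (ht : k • t = 0) : t = 0 := by
  let D := (univPairing n).toData (univPairing_sum_one_zero hn) univPairing_sum_zero_two
  have hD : D.val = (univPairing n).val := (univPairing n).toData_val _ _
  let Ψ := Symbol.lift (Symbol.ofData D fun p => coinvV (cokerRep n) (cokerGen n p))
  have hh : ∀ p, coinvV (cokerRep n) (cokerGen n p) + coinvV (cokerRep n) (cokerGen n p) =
      D.diag p 0 := fun p => by
    rw [← univPairing_val_one, ← hD, PairingData.val_one]
  let U := (Symbol.data n).toPairing hn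
  let Φ := coinvLiftBilin (cokerRep n) U.cokerForm fun g a => U.cokerForm_rep g a a
  let P : AddSubgroup (rep (cokerRep n)).Coinvariants :=
    { carrier := {t | ∃ l, l + l = Φ t ∧ Ψ l = t}
      zero_mem' := ⟨0, by simp, by simp⟩
      add_mem' := by
        rintro s t ⟨l, hl, rfl⟩ ⟨l', hl', rfl⟩
        exact ⟨l + l', by rw [map_add Φ, ← hl, ← hl']; abel, map_add _ _ _⟩
      neg_mem' := by
        rintro t ⟨l, hl, rfl⟩
        exact ⟨-l, by rw [map_neg Φ, ← hl]; abel, map_neg _ _⟩ }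
  have hP : P = ⊤ := by
    refine addSubgroup_coinvariants_eq_top _ closure_cokerGen ?_ ?_
    · rintro _ ⟨g, p, rfl⟩
      rw [coinvV_smul]
      refine ⟨Symbol.single (.diag p 0), ?_, Symbol.lift_ofData_diag _ _ _⟩
      rw [coinvLiftBilin_coinvV, ← Symbol.data_val_one]
      have := U.cokerForm_gen p p 1
      rw [map_one, Module.End.one_apply] at this
      rw [this]
      rfl
    · rintro _ ⟨g, p, rfl⟩ _ ⟨h, q, rfl⟩
      rw [coinvPolar_comm, coinvPolar_smul_left, coinvPolar_comm, cokerRep_cokerRep,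
        ← univPairing_val]
      refine ⟨(Symbol.data n).val p q (h⁻¹ * g), ?_, ?_⟩
      · rw [univPairing_val, coinvLiftBilin_coinvPolar, U.cokerForm_comm (cokerGen n q),
          U.cokerForm_gen]
        rfl
      · rw [← hD]
        exact Symbol.lift_ofData_val D _ hh p q _
  obtain ⟨l, hl, hlt⟩ : t ∈ P := hP ▸ AddSubgroup.mem_top t
  have h0 : (2 * k) • l = 0 := by
    rw [mul_comm, mul_smul, two_smul, hl, ← map_nsmul, ht, map_zero]
  have hl0 : l = 0 := (smul_eq_zero.1 h0).resolve_left (by omega)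
  rw [← hlt, hl0, map_zero]

end DihedralSyzygy

theorem theorem6p1 (n : ℕ) [NeZero n] (hn : Even n) :
    Nonempty ((DihedralSyzygy.cokerRep n).Equiv (DihedralSyzygy.kerRep n).dual) ∧
      Subsingleton (TateH0 (WhiteheadGamma.rep (DihedralSyzygy.cokerRep n))) :=
  ⟨DihedralSyzygy.nonempty_cokerRep_equiv_dual_kerRep,
    subsingleton_tateH0 _ fun k t => DihedralSyzygy.coinvariants_torsionFree hn k t⟩
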